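/- Let $k$ be an algebraically closed field of arbitrary characteristic. A general smooth cubic surface in $\mathbb{P}^3_k$ can be defined, in appropriate coordinates, by a form $$\sum_{i=0}^3 x_i^3+\sum_{0\le i<j<l\le 3} a_{ijl}\,x_ix_jx_l,\qquad a_{ijl}\in k.$$ That is: in the set of smooth cubic surfaces, with the Zariski topology induced from the projective space $\mathbb{P}^{19}_k$ of cubic forms in four variables up to scalars, there is a nonempty open dense subset $U$ such that for every surface in $U$ and every cubic form $F$ defining it there are $g=(g_{ij})\in \mathrm{GL}_4(k)$ and parameters $a_{012},a_{013},a_{023},a_{123}\in k$ for which the substitution $x_i\mapsto\sum_j g_{ij}x_j$ takes $F$ to the displayed form. -/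

import Mathlib

open MvPolynomial

noncomputable section

/-- Monomials of degree `3` in `x₀, x₁, x₂, x₃`; they index the coefficients of a cubic form. -/
abbrev CubicMonomial : Type := {m : Fin 4 →₀ ℕ // m.degree = 3}

/-- `F` is a cubic form in four variables whose zero scheme in `ℙ³` is smooth, over an
algebraically closed field `k` (projective Jacobian criterion; the condition `F(x) = 0` is
not implied by the vanishing of the partial derivatives in characteristic `3`).
The zero form does not satisfy this. -/
structure IsSmoothCubicForm {k : Type*} [Field k] (F : MvPolynomial (Fin 4) k) : Prop where
  isHomogeneous : F.IsHomogeneous 3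
  smooth : ∀ x : Fin 4 → k, x ≠ 0 → eval x F = 0 → ∃ i, eval x (pderiv i F) ≠ 0

/-- Smooth cubic surfaces in `ℙ³` over `k`, each given by a defining cubic form. -/
def SmoothCubic (k : Type*) [Field k] : Type _ :=
  {F : MvPolynomial (Fin 4) k // IsSmoothCubicForm F}

/-- The value of a polynomial `Φ` in the twenty coefficients of a cubic form at the form `F`. -/
def evalCoeffs {k : Type*} [Field k] (Φ : MvPolynomial CubicMonomial k)
    (F : MvPolynomial (Fin 4) k) : k :=
  eval (fun m : CubicMonomial => coeff m.1 F) Φ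

/-- The Zariski topology on smooth cubic surfaces, as a subset of the projective space `ℙ¹⁹` of
all cubic forms up to scalars: the basic open sets are the loci where a homogeneous polynomial
in the coefficients does not vanish. (On defining forms, this is the topology
pulled back from `ℙ¹⁹`; all of its open sets are stable under rescaling the form.) -/
instance SmoothCubic.zariskiTopology (k : Type*) [Field k] : TopologicalSpace (SmoothCubic k) :=
  TopologicalSpace.generateFrom
    {U | ∃ (Φ : MvPolynomial CubicMonomial k) (d : ℕ), Φ.IsHomogeneous d ∧
      U = {F : SmoothCubic k | evalCoeffs Φ F.1 ≠ 0}}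

/-- The form `F` after the linear change of coordinates `x_i ↦ ∑ j, g_ij x_j`. -/
def changeCoords {k : Type*} [Field k] (g : GL (Fin 4) k) (F : MvPolynomial (Fin 4) k) :
    MvPolynomial (Fin 4) k :=
  bind₁ (fun i => ∑ j, C (g.1 i j) * X j) F

/-- `∑ xᵢ³ + ∑_{i<j<l} a_{ijl} xᵢ xⱼ xₗ`; only the values `a i j l` with `i < j < l` matter. -/
def emchForm {k : Type*} [Field k] (a : Fin 4 → Fin 4 → Fin 4 → k) : MvPolynomial (Fin 4) k :=
  ∑ i, X i ^ 3 +
    ∑ i, ∑ j ∈ Finset.Ioi i, ∑ l ∈ Finset.Ioi j, C (a i j l) * (X i * X j * X l)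

end

/-! It suffices to write a general cubic form as ∑ cᵢLᵢ³ + ∑ a_{ijl}LᵢLⱼLₗ with independent linear
forms Lᵢ and all cᵢ ≠ 0, since cube roots of the cᵢ can then be absorbed into the Lᵢ
(`exists_changeCoords_generalForm`). At Lᵢ = xᵢ, c = 1 and a suitable a, the derivative of this
parametrization is onto the cubic forms (`exists_monomial_mem_range_formDeriv`). The cᵢ are needed
in characteristic 3, where Lᵢ³ has zero derivative in Lᵢ and the monomials xᵢ³ would be missed.

Choosing a preimage of each of the twenty monomials gives a polynomial endomorphism of affine
20-space whose derivative at the origin is the identity. It is dominant in every characteristic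
(`algebraicIndependent_of_lines`), so by Chevalley's theorem and the Nullstellensatz its image
contains a nonempty principal open set (`exists_forall_exists_eval_eq`).

A nonzero homogeneous component of the polynomial defining that set yields U. Density follows by
moving along lines of cubic forms, on which smoothness fails for only finitely many parameters
(`IsSmoothCubicForm.exists_polynomial`). -/

/-! ### Dominant polynomial maps -/

theorem finite_degree_eq {σ : Type*} [Finite σ] (n : ℕ) :
    Finite {m : σ →₀ ℕ // m.degree = n} :=
  (Finsupp.finite_of_degree_eq n).to_subtype

/-- The image of a nonempty principal open subset under a dominant endomorphism of affine space
contains a nonempty principal open subset. -/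
theorem exists_forall_exists_eval_eq {σ k : Type*} [Finite σ] [Field k] [IsAlgClosed k]
    (f : σ → MvPolynomial σ k) (hf : AlgebraicIndependent k f)
    (h : MvPolynomial σ k) (hh : h ≠ 0) :
    ∃ Φ : MvPolynomial σ k, Φ ≠ 0 ∧ ∀ y : σ → k, eval y Φ ≠ 0 →
      ∃ x : σ → k, (∀ i, eval x (f i) = y i) ∧ eval x h ≠ 0 := by
  set φ : MvPolynomial σ k →+* MvPolynomial σ k := (aeval f).toRingHom with hφ
  have hinj : Function.Injective φ := hf
  have hfp : φ.FinitePresentation := by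
    rw [← RingHom.FinitePresentation.of_finiteType]
    refine RingHom.FiniteType.of_comp_finiteType (f := C) ?_
    have : φ.comp C = algebraMap k (MvPolynomial σ k) := by
      ext; simp [hφ]
    rw [this]
    exact RingHom.finiteType_algebraMap.2 inferInstance
  have hcons : Topology.IsConstructible
      (PrimeSpectrum.comap φ '' (PrimeSpectrum.basicOpen h : Set _)) := by
    refine PrimeSpectrum.isConstructible_comap_image hfp ?_
    -- D(h) as a single constructible piece: no equations and the one inequation h ≠ 0.
    exact PrimeSpectrum.exists_constructibleSetData_iff.1
      ⟨{⟨h, 0, fun i => 0⟩}, by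
        simp [PrimeSpectrum.ConstructibleSetData.toSet,
          PrimeSpectrum.BasicConstructibleSetData.toSet, Set.compl_eq_univ_sdiff]⟩
  obtain ⟨S, hS⟩ := PrimeSpectrum.exists_constructibleSetData_iff.2 hcons
  -- By injectivity of φ the generic point is the image of the generic point. The equations of the
  -- piece containing it are therefore all zero, and that piece is a principal open set.
  have hbot : (⊥ : PrimeSpectrum (MvPolynomial σ k)) ∈ S.toSet := by
    rw [hS]
    refine ⟨⊥, ?_, ?_⟩
    · simpa [PrimeSpectrum.mem_basicOpen] using hh
    · ext x
      simp [map_eq_zero_iff φ hinj]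
  simp only [PrimeSpectrum.ConstructibleSetData.toSet, Set.mem_iUnion] at hbot
  obtain ⟨c, hc, hc1⟩ := hbot
  simp only [PrimeSpectrum.BasicConstructibleSetData.toSet, Set.mem_sdiff,
    PrimeSpectrum.mem_zeroLocus] at hc1
  obtain ⟨hg, hf0⟩ := hc1
  refine ⟨c.f, by simpa using hf0, fun y hy => ?_⟩
  let m : PrimeSpectrum (MvPolynomial σ k) := ⟨RingHom.ker (eval y), RingHom.ker_isPrime _⟩
  have hm : m ∈ S.toSet := by
    simp only [PrimeSpectrum.ConstructibleSetData.toSet, Set.mem_iUnion]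
    refine ⟨c, hc, ?_⟩
    simp only [PrimeSpectrum.BasicConstructibleSetData.toSet, Set.mem_sdiff,
      PrimeSpectrum.mem_zeroLocus]
    refine ⟨fun z hz => ?_, ?_⟩
    · have : z = 0 := by simpa using hg hz
      simp [this]
    · simpa [m] using hy
  rw [hS] at hm
  obtain ⟨q, hq, hqm⟩ := hm
  -- The prime q over y need not be maximal; the Nullstellensatz supplies a closed point of V(q)
  -- outside V(h).
  have hq' : h ∉ vanishingIdeal k (zeroLocus k q.asIdeal) := by
    rw [IsPrime.vanishingIdeal_zeroLocus]
    exact hq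
  rw [mem_vanishingIdeal_iff] at hq'
  push Not at hq'
  obtain ⟨x, hx, hxh⟩ := hq'
  refine ⟨x, fun i => ?_, by simpa [aeval_eq_eval] using hxh⟩
  have hmem : (X i - C (y i) : MvPolynomial σ k) ∈ m.asIdeal := by simp [m]
  rw [← hqm] at hmem
  have := (mem_zeroLocus_iff.1 hx) _ hmem
  simpa [hφ, sub_eq_zero, aeval_eq_eval] using this

theorem aeval_mul_of_isHomogeneous {σ k A : Type*} [CommRing k] [CommRing A]
    [Algebra k A] {Q : MvPolynomial σ k} {d : ℕ} (hQ : Q.IsHomogeneous d) (t : A) (u : σ → A) :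
    aeval (fun i => t * u i) Q = t ^ d * aeval u Q := by
  rw [aeval_def, aeval_def, eval₂_eq, eval₂_eq, Finset.mul_sum]
  refine Finset.sum_congr rfl fun m hm => ?_
  have hd : m.degree = d := by
    by_contra hne
    exact (mem_support_iff.1 hm) (hQ.coeff_eq_zero hne)
  simp only [mul_pow, Finset.prod_mul_distrib, Finset.prod_pow_eq_pow_sum]
  rw [← hd, Finsupp.degree_apply]
  ring

/-- An endomorphism of affine space whose derivative at the origin is the identity is dominant. -/
theorem algebraicIndependent_of_lines {σ k : Type*} [Finite σ] [Field k] [Infinite k]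
    (f : σ → MvPolynomial σ k) (c : σ → k)
    (h : ∀ (y : σ → k) (i : σ), (Polynomial.X ^ 2 : Polynomial k) ∣
      aeval (fun j => Polynomial.C (y j) * Polynomial.X) (f i)
        - (Polynomial.C (c i) + Polynomial.C (y i) * Polynomial.X)) :
    AlgebraicIndependent k f := by
  rw [AlgebraicIndependent, injective_iff_map_eq_zero]
  intro Q hQ
  by_contra hne
  -- Translate so that the relation holds between the fᵢ - cᵢ, which vanish at the origin. Along the
  -- line through y its lowest component, of degree d, contributes Q'_d(y)·X^d modulo X^(d+1), so
  -- Q'_d vanishes at every y.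
  set τ : MvPolynomial σ k →ₐ[k] MvPolynomial σ k := aeval (fun i => X i + C (c i)) with hτ
  set Q' := τ Q with hQ'
  have hback : aeval (fun i => X i - C (c i)) Q' = Q := by
    rw [hQ', ← AlgHom.comp_apply]
    conv_rhs => rw [← AlgHom.id_apply (R := k) Q]
    congr 1
    ext i
    simp [hτ, algebraMap_eq]
  have hQne : Q' ≠ 0 := by
    intro h0
    rw [h0, map_zero] at hback
    exact hne hback.symm
  have hz : aeval (fun i => f i - C (c i)) Q' = 0 := by
    rw [← hQ, hQ', ← AlgHom.comp_apply]
    congr 1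
    ext i
    simp [hτ, algebraMap_eq]
  have hex : ∃ d, homogeneousComponent d Q' ≠ 0 := by
    by_contra! hall
    exact hQne (by rw [← sum_homogeneousComponent Q']; simp [hall])
  classical
  set d := Nat.find hex with hd
  have hdne : homogeneousComponent d Q' ≠ 0 := Nat.find_spec hex
  have hlt : ∀ e < d, homogeneousComponent e Q' = 0 := fun e he => by
    simpa using Nat.find_min hex he
  apply hdne
  refine MvPolynomial.funext fun y => ?_
  choose r hr using h y
  set u : σ → Polynomial k := fun i => Polynomial.C (y i) + Polynomial.X * r i with hu
  have hline : aeval (fun i => Polynomial.X * u i) Q' = 0 := by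
    have key : (aeval (R := k) (fun j => Polynomial.C (y j) * Polynomial.X)).comp
        (aeval (fun i => f i - C (c i))) = aeval (fun i => Polynomial.X * u i) := by
      ext1 i
      have := hr i
      simp only [AlgHom.comp_apply, aeval_X, map_sub, hu, ← algebraMap_eq, AlgHom.commutes,
        Polynomial.algebraMap_eq]
      linear_combination this
    rw [← key, AlgHom.comp_apply, hz, map_zero]
  rw [← sum_homogeneousComponent Q', map_sum] at hline
  have hdvd : (Polynomial.X : Polynomial k) ^ (d + 1) ∣
      Polynomial.X ^ d * aeval u (homogeneousComponent d Q') := by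
    have hmem : d ∈ Finset.range (Q'.totalDegree + 1) := by
      by_contra hnot
      exact hdne (homogeneousComponent_eq_zero _ _ (by simpa using hnot))
    rw [← Finset.add_sum_erase _ _ hmem,
      aeval_mul_of_isHomogeneous (homogeneousComponent_isHomogeneous d Q')] at hline
    rw [eq_neg_of_add_eq_zero_left hline, dvd_neg]
    refine Finset.dvd_sum fun e he => ?_
    rw [aeval_mul_of_isHomogeneous (homogeneousComponent_isHomogeneous e Q')]
    rcases lt_or_ge e d with hed | hed
    · simp [hlt e hed]
    · have : d + 1 ≤ e := lt_of_le_of_ne hed (Finset.ne_of_mem_erase he).symm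
      exact (pow_dvd_pow _ this).mul_right _
  rw [pow_succ, mul_dvd_mul_iff_left (pow_ne_zero _ Polynomial.X_ne_zero),
    Polynomial.X_dvd_iff, Polynomial.coeff_zero_eq_eval_zero] at hdvd
  rw [map_zero, ← hdvd, ← Polynomial.coe_evalRingHom, ← RingHom.coe_coe (aeval u),
    ← RingHom.comp_apply]
  congr 1
  ext i
  · simp
  · simp [hu]

/-! ### Smoothness along a line of cubic forms -/

theorem MvPolynomial.homogeneousComponent_mul_right {σ k : Type*} [CommRing k]
    (A : MvPolynomial σ k) {G : MvPolynomial σ k} {e n : ℕ} (hG : G.IsHomogeneous e)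
    (hen : e ≤ n) :
    homogeneousComponent n (A * G) = homogeneousComponent (n - e) A * G := by
  conv_lhs => rw [← sum_homogeneousComponent A, Finset.sum_mul, map_sum]
  have hterm : ∀ j, homogeneousComponent n (homogeneousComponent j A * G) =
      if j = n - e then homogeneousComponent (n - e) A * G else 0 := fun j => by
    rw [homogeneousComponent_of_mem ((homogeneousComponent_isHomogeneous j A).mul hG)]
    split_ifs with h1 h2 h2
    · rw [h2]
    · omega
    · omega
    · rfl
  simp only [hterm, Finset.sum_ite_eq', Finset.mem_range]
  split_ifs with h
  · rfl
  · rw [homogeneousComponent_eq_zero _ _ (by omega), zero_mul]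

/-- A cubic form near a smooth one on a line of cubic forms is smooth. -/
theorem IsSmoothCubicForm.exists_polynomial {k : Type*} [Field k] [IsAlgClosed k]
    {F H : MvPolynomial (Fin 4) k} (hF : IsSmoothCubicForm F) (hH : H.IsHomogeneous 3) :
    ∃ p : Polynomial k, p ≠ 0 ∧ ∀ t : k, p.eval t ≠ 0 → IsSmoothCubicForm (F + C t * H) := by
  classical
  let G : MvPolynomial (Fin 4) k → Option (Fin 4) → MvPolynomial (Fin 4) k :=
    fun F o => o.elim F (fun i => pderiv i F)
  let e : Option (Fin 4) → ℕ := fun o => o.elim 3 (fun _ => 2)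
  have he : ∀ o, e o ≤ 3 := by rintro (_ | _) <;> simp [e]
  have hGe : ∀ F : MvPolynomial (Fin 4) k, F.IsHomogeneous 3 → ∀ o, (G F o).IsHomogeneous (e o) := by
    rintro F hF (_ | i)
    · exact hF
    · exact hF.pderiv
  have hGadd : ∀ t o, G (F + C t * H) o = G F o + C t * G H o := by
    rintro t (_ | i) <;> simp [G]
  set I := Ideal.span (Set.range (G F)) with hI
  -- Nullstellensatz: F and its partials have no common zero except possibly the origin.
  have hrad : idealOfVars (Fin 4) k ≤ I.radical := by
    rw [idealOfVars, Ideal.span_le]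
    rintro _ ⟨i, rfl⟩
    rw [SetLike.mem_coe, ← vanishingIdeal_zeroLocus_eq_radical (K := k), mem_vanishingIdeal_iff]
    intro x hx
    have hGx : ∀ o, eval x (G F o) = 0 := fun o => by
      simpa [aeval_eq_eval] using mem_zeroLocus_iff.1 hx _ (Ideal.subset_span ⟨o, rfl⟩)
    by_cases hx0 : x = 0
    · simp [hx0]
    · obtain ⟨i, hi⟩ := hF.smooth x hx0 (hGx none)
      exact absurd (hGx (some i)) hi
  obtain ⟨n, hn⟩ := Ideal.exists_pow_le_of_le_radical_of_fg hrad
    (IsNoetherian.noetherian _)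
  -- Large enough that all monomials of degree M lie in I, and that M - `e o` is not truncated.
  set M := n + 3 with hM
  have : Finite {m : Fin 4 →₀ ℕ // m.degree = M} := finite_degree_eq M
  let : Fintype {m : Fin 4 →₀ ℕ // m.degree = M} := Fintype.ofFinite _
  have hrep : ∀ m : {m : Fin 4 →₀ ℕ // m.degree = M}, ∃ A : Option (Fin 4) → MvPolynomial (Fin 4) k,
      (∀ o, (A o).IsHomogeneous (M - e o)) ∧ ∑ o, A o * G F o = monomial m.1 1 := by
    intro m
    have hm : monomial m.1 (1 : k) ∈ I := by
      apply hn
      rw [monomial_mem_pow_idealOfVars_iff _ _ one_ne_zero, m.2]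
      omega
    obtain ⟨B, hB⟩ := Ideal.mem_span_range_iff_exists_fun.1 hm
    refine ⟨fun o => homogeneousComponent (M - e o) (B o),
      fun o => homogeneousComponent_isHomogeneous _ _, ?_⟩
    have h2 := congrArg (homogeneousComponent M) hB
    rw [homogeneousComponent_of_mem (m := M) (isHomogeneous_monomial _ m.2), if_pos rfl,
      map_sum] at h2
    rw [← h2]
    refine Finset.sum_congr rfl fun o _ => ?_
    rw [homogeneousComponent_mul_right _ (hGe F hF.isHomogeneous o) ((he o).trans (by omega))]
  choose A hA hAF using hrep
  set E : {m : Fin 4 →₀ ℕ // m.degree = M} → MvPolynomial (Fin 4) k :=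
    fun m => ∑ o, A m o * G H o with hE
  have hEhom : ∀ m, (E m).IsHomogeneous M := by
    intro m
    refine IsHomogeneous.sum _ _ _ fun o _ => ?_
    have := (hA m o).mul (hGe H hH o)
    rwa [Nat.sub_add_cancel ((he o).trans (by omega))] at this
  -- At a singular point x of F + tH, the vector v of degree-M monomials at x satisfies (1 + tN)v =
  -- 0. Where the determinant is nonzero this forces each xᵢ^M = 0.
  set N : Matrix {m : Fin 4 →₀ ℕ // m.degree = M} {m : Fin 4 →₀ ℕ // m.degree = M} k :=
    fun m n => coeff n.1 (E m) with hN
  set p : Polynomial k := ((1 : Matrix _ _ (Polynomial k)) +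
    (Polynomial.X : Polynomial k) • N.map Polynomial.C).det with hp
  have hpe : ∀ t, p.eval t = (1 + t • N).det := by
    intro t
    rw [hp, ← Polynomial.coe_evalRingHom, RingHom.map_det]
    congr 1
    ext i j
    simp [Matrix.one_apply, apply_ite]
    ring
  refine ⟨p, ?_, fun t ht => ⟨hF.isHomogeneous.add (hH.C_mul t), fun x hx0 hx => ?_⟩⟩
  · intro h0
    have := hpe 0
    simp [h0] at this
  by_contra! hall
  have hGx : ∀ o, eval x (G F o) = - (t * eval x (G H o)) := by
    intro o
    have : eval x (G (F + C t * H) o) = 0 := by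
      rcases o with _ | i
      · exact hx
      · exact hall i
    rw [hGadd] at this
    simp only [map_add, map_mul, eval_C] at this
    linear_combination this
  rw [hpe] at ht
  have hv := Matrix.eq_zero_of_mulVec_eq_zero ht
    (v := fun m : {m : Fin 4 →₀ ℕ // m.degree = M} => eval x (monomial m.1 (1 : k))) (by
    ext m
    rw [Matrix.add_mulVec, Matrix.one_mulVec, Matrix.smul_mulVec, Pi.add_apply, Pi.smul_apply,
      Pi.zero_apply]
    have h1 : N.mulVec (fun m => eval x (monomial m.1 (1 : k))) m = eval x (E m) := by
      have hsum : E m = ∑ n : {m : Fin 4 →₀ ℕ // m.degree = M},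
          C (coeff n.1 (E m)) * monomial n.1 1 := by
        ext s
        simp only [coeff_sum, coeff_C_mul, coeff_monomial, mul_ite, mul_one, mul_zero]
        by_cases hs : s.degree = M
        · rw [Finset.sum_eq_single ⟨s, hs⟩]
          · simp
          · rintro b - hb
            rw [if_neg]
            rintro rfl
            exact hb rfl
          · simp
        · rw [(hEhom m).coeff_eq_zero hs, Finset.sum_eq_zero]
          rintro b -
          rw [if_neg]
          rintro rfl
          exact hs b.2
      rw [hsum]
      simp [Matrix.mulVec, dotProduct, hN]
    rw [h1, ← hAF m, hE]
    simp only [map_sum, map_mul, hGx, smul_eq_mul, Finset.mul_sum, ← Finset.sum_add_distrib]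
    refine Finset.sum_eq_zero fun o _ => by ring)
  apply hx0
  ext i
  have hi : eval x (monomial (Finsupp.single i M) (1 : k)) = 0 :=
    congrFun hv ⟨Finsupp.single i M, by simp⟩
  rw [eval_monomial, one_mul, Finsupp.prod_single_index (by simp)] at hi
  exact eq_zero_of_pow_eq_zero hi

/-! ### The parametrized family and its derivative -/

/-- The linear forms with coefficients the rows of a matrix. -/
noncomputable def rowForm {R : Type*} [CommRing R] (M : Matrix (Fin 4) (Fin 4) R) (i : Fin 4) :
    MvPolynomial (Fin 4) R :=
  ∑ j, C (M i j) * X j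

/-- The cubic form `∑ cᵢ Lᵢ³ + ∑_{i<j<l} a_{ijl} Lᵢ Lⱼ Lₗ`, where `Lᵢ = ∑ⱼ Mᵢⱼ xⱼ`. -/
noncomputable def generalForm {R : Type*} [CommRing R] (M : Matrix (Fin 4) (Fin 4) R)
    (c : Fin 4 → R) (a : Fin 4 → Fin 4 → Fin 4 → R) : MvPolynomial (Fin 4) R :=
  ∑ i, C (c i) * (rowForm M i * rowForm M i * rowForm M i) +
    ∑ i, ∑ j ∈ Finset.Ioi i, ∑ l ∈ Finset.Ioi j,
      C (a i j l) * (rowForm M i * rowForm M j * rowForm M l)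

/-- The parameters of `generalForm`. -/
abbrev FormParam (R : Type*) : Type _ :=
  Matrix (Fin 4) (Fin 4) R × (Fin 4 → R) × (Fin 4 → Fin 4 → Fin 4 → R)

theorem rowForm_add {R : Type*} [CommRing R] (M N : Matrix (Fin 4) (Fin 4) R) (i : Fin 4) :
    rowForm (M + N) i = rowForm M i + rowForm N i := by
  simp [rowForm, add_mul, Finset.sum_add_distrib]

theorem rowForm_smul {R : Type*} [CommRing R] (r : R) (M : Matrix (Fin 4) (Fin 4) R)
    (i : Fin 4) : rowForm (r • M) i = C r * rowForm M i := by
  simp [rowForm, Finset.mul_sum, mul_assoc]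

theorem rowForm_one {R : Type*} [CommRing R] (i : Fin 4) :
    rowForm (1 : Matrix (Fin 4) (Fin 4) R) i = X i := by
  simp [rowForm, Matrix.one_apply, apply_ite]

theorem map_rowForm {R S : Type*} [CommRing R] [CommRing S] (φ : R →+* S)
    (M : Matrix (Fin 4) (Fin 4) R) (i : Fin 4) :
    map φ (rowForm M i) = rowForm (M.map φ) i := by
  simp [rowForm]

/-- A summand of the derivative of `generalForm` at `(1, c, a)`: the derivative of
`a Lᵢ Lⱼ Lₗ`. -/
noncomputable def termDeriv {k : Type*} [Field k] (a a' : k) (M : Matrix (Fin 4) (Fin 4) k)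
    (i j l : Fin 4) : MvPolynomial (Fin 4) k :=
  C a' * (X i * X j * X l) +
    C a * (rowForm M i * X j * X l + X i * rowForm M j * X l + X i * X j * rowForm M l)

theorem termDeriv_add {k : Type*} [Field k] (a a' b' : k) (M N : Matrix (Fin 4) (Fin 4) k)
    (i j l : Fin 4) :
    termDeriv a (a' + b') (M + N) i j l = termDeriv a a' M i j l + termDeriv a b' N i j l := by
  simp only [termDeriv, rowForm_add, C_add]
  ring

theorem termDeriv_smul {k : Type*} [Field k] (r a a' : k) (M : Matrix (Fin 4) (Fin 4) k)
    (i j l : Fin 4) :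
    termDeriv a (r * a') (r • M) i j l = C r * termDeriv a a' M i j l := by
  simp only [termDeriv, rowForm_smul, C_mul]
  ring

/-- The derivative of `generalForm` at `(1, c, a)`. -/
noncomputable def formDeriv {k : Type*} [Field k] (c : Fin 4 → k)
    (a : Fin 4 → Fin 4 → Fin 4 → k) : FormParam k →ₗ[k] MvPolynomial (Fin 4) k where
  toFun v := ∑ i, termDeriv (c i) (v.2.1 i) v.1 i i i +
    ∑ i, ∑ j ∈ Finset.Ioi i, ∑ l ∈ Finset.Ioi j, termDeriv (a i j l) (v.2.2 i j l) v.1 i j l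
  map_add' v w := by
    simp only [Prod.fst_add, Prod.snd_add, Pi.add_apply, termDeriv_add, Finset.sum_add_distrib]
    exact add_add_add_comm _ _ _ _
  map_smul' r v := by
    simp only [Prod.smul_fst, Prod.smul_snd, Pi.smul_apply, smul_eq_mul, termDeriv_smul,
      RingHom.id_apply, smul_eq_C_mul, mul_add, Finset.mul_sum]

theorem formDeriv_apply {k : Type*} [Field k] (c : Fin 4 → k)
    (a : Fin 4 → Fin 4 → Fin 4 → k) (v : FormParam k) :
    formDeriv c a v = ∑ i, termDeriv (c i) (v.2.1 i) v.1 i i i +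
      ∑ i, ∑ j ∈ Finset.Ioi i, ∑ l ∈ Finset.Ioi j,
        termDeriv (a i j l) (v.2.2 i j l) v.1 i j l :=
  rfl

theorem map_generalForm {R S : Type*} [CommRing R] [CommRing S] (φ : R →+* S)
    (M : Matrix (Fin 4) (Fin 4) R) (c : Fin 4 → R) (a : Fin 4 → Fin 4 → Fin 4 → R) :
    map φ (generalForm M c a) =
      generalForm (M.map φ) (fun i => φ (c i)) (fun i j l => φ (a i j l)) := by
  simp [generalForm, map_rowForm]

theorem isHomogeneous_rowForm {R : Type*} [CommRing R] (M : Matrix (Fin 4) (Fin 4) R)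
    (i : Fin 4) : (rowForm M i).IsHomogeneous 1 :=
  IsHomogeneous.sum _ _ _ fun _ _ => isHomogeneous_C_mul_X _ _

theorem isHomogeneous_generalForm {R : Type*} [CommRing R] (M : Matrix (Fin 4) (Fin 4) R)
    (c : Fin 4 → R) (a : Fin 4 → Fin 4 → Fin 4 → R) : (generalForm M c a).IsHomogeneous 3 := by
  have h3 : ∀ i j l, (rowForm M i * rowForm M j * rowForm M l).IsHomogeneous 3 := fun i j l =>
    ((isHomogeneous_rowForm M i).mul (isHomogeneous_rowForm M j)).mul (isHomogeneous_rowForm M l)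
  refine IsHomogeneous.add ?_ ?_
  · exact IsHomogeneous.sum _ _ _ fun i _ => (h3 i i i).C_mul _
  · exact IsHomogeneous.sum _ _ _ fun i _ => IsHomogeneous.sum _ _ _ fun j _ =>
      IsHomogeneous.sum _ _ _ fun l _ => (h3 i j l).C_mul _

theorem sq_dvd_trilinear_sub {A : Type*} [CommRing A] (t a a' x x' y y' z z' : A) :
    t ^ 2 ∣ (a + t * a') * ((x + t * x') * (y + t * y') * (z + t * z')) -
      (a * (x * y * z) + t * (a' * (x * y * z) + a * (x' * y * z + x * y' * z + x * y * z'))) :=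
  ⟨a * (x * y' * z' + x' * y * z' + x' * y' * z + t * x' * y' * z') +
    a' * (x' * y * z + x * y' * z + x * y * z' + t * (x * y' * z' + x' * y * z' + x' * y' * z) +
      t ^ 2 * x' * y' * z'), by ring⟩

/-- This justifies calling `formDeriv` the derivative: a first-order expansion over k[t]. Cubes and
mixed products are both instances of the trilinear expansion. -/
theorem sq_dvd_generalForm_sub {k : Type*} [Field k] (c : Fin 4 → k)
    (a : Fin 4 → Fin 4 → Fin 4 → k) (v : FormParam k) :
    (C (Polynomial.X ^ 2) : MvPolynomial (Fin 4) (Polynomial k)) ∣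
      generalForm (1 + (Polynomial.X : Polynomial k) • v.1.map Polynomial.C)
        (fun i => Polynomial.C (c i) + Polynomial.X * Polynomial.C (v.2.1 i))
        (fun i j l => Polynomial.C (a i j l) + Polynomial.X * Polynomial.C (v.2.2 i j l)) -
      (map Polynomial.C (generalForm 1 c a) +
        C Polynomial.X * map Polynomial.C (formDeriv c a v)) := by
  simp only [generalForm, formDeriv_apply, rowForm_add, rowForm_smul, rowForm_one,
    ← map_rowForm, map_add, map_sum, mul_add (C Polynomial.X), Finset.mul_sum, C_pow]
  rw [add_add_add_comm, add_sub_add_comm]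
  simp only [← Finset.sum_add_distrib, ← Finset.sum_sub_distrib]
  have hterm : ∀ (b b' : k) (i j l : Fin 4),
      (C Polynomial.X : MvPolynomial (Fin 4) (Polynomial k)) ^ 2 ∣
        (C (Polynomial.C b) + C (Polynomial.X * Polynomial.C b')) *
          ((X i + C Polynomial.X * map Polynomial.C (rowForm v.1 i)) *
            (X j + C Polynomial.X * map Polynomial.C (rowForm v.1 j)) *
            (X l + C Polynomial.X * map Polynomial.C (rowForm v.1 l))) -
        (map Polynomial.C (C b * (X i * X j * X l)) +
          C Polynomial.X * map Polynomial.C (termDeriv b b' v.1 i j l)) := fun b b' i j l => by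
    convert sq_dvd_trilinear_sub (C Polynomial.X) (C (Polynomial.C b)) (C (Polynomial.C b'))
      (X i) (map Polynomial.C (rowForm v.1 i)) (X j) (map Polynomial.C (rowForm v.1 j))
      (X l) (map Polynomial.C (rowForm v.1 l)) using 1
    simp only [termDeriv, map_add, map_mul, map_X, map_C]
  exact Finset.dvd_sum fun i _ => dvd_add (hterm _ _ i i i)
    (Finset.dvd_sum fun j _ => Finset.dvd_sum fun l _ => hterm _ _ i j l)

/-! ### Surjectivity of the derivative -/

theorem sum_ordered_triples {A : Type*} [AddCommMonoid A] (f : Fin 4 → Fin 4 → Fin 4 → A) :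
    ∑ i, ∑ j ∈ Finset.Ioi i, ∑ l ∈ Finset.Ioi j, f i j l =
      f 0 1 2 + f 0 1 3 + f 0 2 3 + f 1 2 3 := by
  have h0 : Finset.Ioi (0 : Fin 4) = {1, 2, 3} := by decide
  have h1 : Finset.Ioi (1 : Fin 4) = {2, 3} := by decide
  have h2 : Finset.Ioi (2 : Fin 4) = {3} := by decide
  have h3 : Finset.Ioi (3 : Fin 4) = ∅ := by decide
  simp [Fin.sum_univ_four, h0, h1, h2, h3, add_assoc]

theorem rowForm_zero {R : Type*} [CommRing R] (i : Fin 4) :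
    rowForm (0 : Matrix (Fin 4) (Fin 4) R) i = 0 := by
  simp [rowForm]

theorem rowForm_single {R : Type*} [CommRing R] (i j n : Fin 4) :
    rowForm (Matrix.single i j (1 : R)) n = if n = i then X j else 0 := by
  by_cases h : n = i
  · subst h
    simp [rowForm, Matrix.single_apply, apply_ite]
  · simp [rowForm, h, Ne.symm h]

theorem cube_mem_range_formDeriv {k : Type*} [Field k] (c : Fin 4 → k)
    (a : Fin 4 → Fin 4 → Fin 4 → k) (i : Fin 4) :
    (X i * X i * X i : MvPolynomial (Fin 4) k) ∈ LinearMap.range (formDeriv c a) := by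
  refine ⟨(0, Pi.single i 1, 0), ?_⟩
  simp [formDeriv_apply, termDeriv, rowForm_zero, Pi.single_apply, apply_ite]

theorem mul_mem_range_formDeriv {k : Type*} [Field k] (c : Fin 4 → k)
    (a : Fin 4 → Fin 4 → Fin 4 → k) {i j l : Fin 4} (hij : i ≠ j) (hil : i ≠ l) (hjl : j ≠ l) :
    (X i * X j * X l : MvPolynomial (Fin 4) k) ∈ LinearMap.range (formDeriv c a) := by
  have hord : ∀ i j l : Fin 4, i < j → j < l →
      (X i * X j * X l : MvPolynomial (Fin 4) k) ∈ LinearMap.range (formDeriv c a) := by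
    intro i j l hij hjl
    refine ⟨(0, 0, fun i' j' l' => if i' = i ∧ j' = j ∧ l' = l then 1 else 0), ?_⟩
    have key : ∀ i j l : Fin 4, i < j → j < l → (i = 0 ∧ j = 1 ∧ l = 2) ∨
      (i = 0 ∧ j = 1 ∧ l = 3) ∨ (i = 0 ∧ j = 2 ∧ l = 3) ∨ (i = 1 ∧ j = 2 ∧ l = 3) := by decide
    rcases key i j l hij hjl with h | h | h | h <;> obtain ⟨rfl, rfl, rfl⟩ := h <;>
      simp [formDeriv_apply, termDeriv, rowForm_zero, sum_ordered_triples]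
  rcases lt_or_gt_of_ne hij with h1 | h1 <;> rcases lt_or_gt_of_ne hil with h2 | h2 <;>
    rcases lt_or_gt_of_ne hjl with h3 | h3
  · exact hord _ _ _ h1 h3
  · convert hord _ _ _ h2 h3 using 1
    ring
  · exact absurd (h1.trans h3) h2.not_gt
  · convert hord _ _ _ h2 h1 using 1
    ring
  · convert hord _ _ _ h1 h2 using 1
    ring
  · exact absurd (h1.trans h2) h3.not_gt
  · convert hord _ _ _ h3 h2 using 1
    ring
  · convert hord _ _ _ h3 h1 using 1
    ring

/-- Away from characteristic 3 the Fermat point a = 0 works: moving Lᵢ towards xⱼ gives 3xᵢ²xⱼ. In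
characteristic 3 that term dies, and a = 1 is used so that the mixed products supply the monomials.
-/
theorem exists_sq_mul_mem_range_formDeriv (k : Type*) [Field k] :
    ∃ a : Fin 4 → Fin 4 → Fin 4 → k, ∀ i j : Fin 4, i ≠ j →
      (X i * X i * X j : MvPolynomial (Fin 4) k) ∈ LinearMap.range (formDeriv (fun _ => 1) a) := by
  by_cases h3 : (3 : k) = 0
  · refine ⟨fun _ _ _ => 1, ?_⟩
    have h3' : (3 : MvPolynomial (Fin 4) k) = 0 := by
      rw [← map_ofNat C, h3, C_0]
    have hT : ∀ i j l m : Fin 4, i ≠ j → i ≠ l → i ≠ m → j ≠ l → j ≠ m → l ≠ m →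
        (X j * (X j * X l + X j * X m + X l * X m) : MvPolynomial (Fin 4) k) ∈
          LinearMap.range (formDeriv (fun _ => 1) (fun _ _ _ => (1 : k))) := by
      intro i j l m hij hil him hjl hjm hlm
      refine ⟨(Matrix.single i j 1, 0, 0), ?_⟩
      -- The vector lists the second elementary symmetric polynomials in the three variables other
      -- than xᵢ.
      have hD : formDeriv (fun _ => 1) (fun _ _ _ => (1 : k)) (Matrix.single i j 1, 0, 0) =
          X j * ![X 1 * X 2 + X 1 * X 3 + X 2 * X 3, X 0 * X 2 + X 0 * X 3 + X 2 * X 3,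
            X 0 * X 1 + X 0 * X 3 + X 1 * X 3, X 0 * X 1 + X 0 * X 2 + X 1 * X 2] i := by
        rw [formDeriv_apply, sum_ordered_triples, Fin.sum_univ_four]
        simp only [termDeriv, rowForm_single]
        fin_cases i
        · simp
          linear_combination (X j * X 0 ^ 2) * h3'
        · simp
          linear_combination (X j * X 1 ^ 2) * h3'
        · simp
          linear_combination (X j * X 2 ^ 2) * h3'
        · simp
          linear_combination (X j * X 3 ^ 2) * h3'
      rw [hD]
      congr 1
      fin_cases i <;> fin_cases j <;> first | exact absurd rfl hij | skip
      all_goals fin_cases l <;> first | exact absurd rfl hil | exact absurd rfl hjl | skip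
      all_goals fin_cases m <;>
        first | exact absurd rfl him | exact absurd rfl hjm | exact absurd rfl hlm | skip
      all_goals simp <;> ring
    intro j i hij
    obtain ⟨l, m, hil, him, hjl, hjm, hlm⟩ : ∃ l m : Fin 4,
        i ≠ l ∧ i ≠ m ∧ j ≠ l ∧ j ≠ m ∧ l ≠ m := by
      revert i j
      decide
    have hi := hT i j l m hij.symm hil him hjl hjm hlm
    have hl := hT l j i m hjl.symm hil.symm hlm hij hjm him
    have hm := hT m j i l hjm.symm him.symm hlm.symm hij hjl hil
    have h1 := mul_mem_range_formDeriv (fun _ => 1) (fun _ _ _ => (1 : k)) hjl hjm hlm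
    have h2 := mul_mem_range_formDeriv (fun _ => 1) (fun _ _ _ => (1 : k)) hij hjm him
    have h4 := mul_mem_range_formDeriv (fun _ => 1) (fun _ _ _ => (1 : k)) hij hjl hil
    -- Modulo squarefree monomials, `hi - hl - hm` is -2xⱼ²xᵢ, which equals xⱼ²xᵢ in characteristic
    -- 3.
    convert add_mem (add_mem (sub_mem (sub_mem (sub_mem hi hl) hm) h1) h2) h4 using 1
    linear_combination (X j * X j * X i) * h3'
  · refine ⟨0, fun i j hij => ?_⟩
    have hD : formDeriv (fun _ => (1 : k)) 0 (Matrix.single i j 1, 0, 0) =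
        (3 : k) • (X i * X i * X j) := by
      simp only [formDeriv_apply, termDeriv, rowForm_single]
      simp [smul_eq_C_mul, Finset.sum_add_distrib, map_ofNat C 3]
      ring
    refine (Submodule.smul_mem_iff _ h3).1 ?_
    rw [← hD]
    exact LinearMap.mem_range_self _ _

/-- The derivative of `generalForm` is onto the cubic forms at a suitable point. -/
theorem exists_monomial_mem_range_formDeriv (k : Type*) [Field k] :
    ∃ a : Fin 4 → Fin 4 → Fin 4 → k, ∀ m : CubicMonomial,
      (monomial m.1 1 : MvPolynomial (Fin 4) k) ∈ LinearMap.range (formDeriv (fun _ => 1) a) := by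
  obtain ⟨a, ha⟩ := exists_sq_mul_mem_range_formDeriv k
  refine ⟨a, fun m => ?_⟩
  obtain ⟨i, j, l, h⟩ : ∃ i j l, Finsupp.toMultiset m.1 = {i, j, l} := by
    rw [← Multiset.card_eq_three, Finsupp.card_toMultiset]
    exact m.2
  have hm : m.1 = Finsupp.single i 1 + Finsupp.single j 1 + Finsupp.single l 1 := by
    apply Function.LeftInverse.injective Finsupp.toMultiset_toFinsupp
    simp only [h, map_add, Finsupp.toMultiset_single, one_smul]
    rfl
  have hX : (monomial m.1 1 : MvPolynomial (Fin 4) k) = X i * X j * X l := by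
    simp [hm, X, monomial_mul]
  rw [hX]
  by_cases hij : i = j
  · subst hij
    by_cases hil : i = l
    · subst hil
      exact cube_mem_range_formDeriv _ _ _
    · exact ha _ _ hil
  · by_cases hil : i = l
    · subst hil
      convert ha _ _ hij using 1
      ring
    · by_cases hjl : j = l
      · subst hjl
        convert ha _ _ (Ne.symm hij) using 1
        ring
      · exact mul_mem_range_formDeriv _ _ hij hil hjl

/-! ### A general cubic form lies in the family -/

theorem exists_eq_generalForm (k : Type*) [Field k] [IsAlgClosed k] :
    ∃ Φ : MvPolynomial CubicMonomial k, Φ ≠ 0 ∧ ∀ F : MvPolynomial (Fin 4) k,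
      F.IsHomogeneous 3 → evalCoeffs Φ F ≠ 0 →
        ∃ M c a, M.det ≠ 0 ∧ (∀ i, c i ≠ 0) ∧ F = generalForm M c a := by
  classical
  have : Finite CubicMonomial := finite_degree_eq 3
  let : Fintype CubicMonomial := Fintype.ofFinite _
  have : Infinite k := IsAlgClosed.instInfinite
  obtain ⟨a₀, ha₀⟩ := exists_monomial_mem_range_formDeriv k
  choose v hv using ha₀
  -- The parameters run over (1, 1, a₀) + ∑ Xₙvₙ, where vₙ is sent by the derivative to the n-th
  -- monomial; this makes the derivative of f at the origin the identity.
  let M : Matrix (Fin 4) (Fin 4) (MvPolynomial CubicMonomial k) :=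
    1 + ∑ n, (X n : MvPolynomial CubicMonomial k) • (v n).1.map C
  let c : Fin 4 → MvPolynomial CubicMonomial k := fun i => C 1 + ∑ n, X n * C ((v n).2.1 i)
  let a : Fin 4 → Fin 4 → Fin 4 → MvPolynomial CubicMonomial k :=
    fun i j l => C (a₀ i j l) + ∑ n, X n * C ((v n).2.2 i j l)
  let f : CubicMonomial → MvPolynomial CubicMonomial k :=
    fun m => coeff m.1 (generalForm M c a)
  have hf : AlgebraicIndependent k f := by
    refine algebraicIndependent_of_lines f
      (fun m => coeff m.1 (generalForm 1 (fun _ => 1) a₀)) fun y m => ?_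
    set ρ : MvPolynomial CubicMonomial k →ₐ[k] Polynomial k :=
      aeval (fun j => Polynomial.C (y j) * Polynomial.X) with hρ
    have hρC : ∀ r, ρ (C r) = Polynomial.C r := fun r => by simp [hρ]
    have hρX : ∀ n, ρ (X n) = Polynomial.C (y n) * Polynomial.X := fun n => by simp [hρ]
    set w : FormParam k := ∑ n, y n • v n with hw
    have hM : M.map ρ = 1 + (Polynomial.X : Polynomial k) • w.1.map Polynomial.C := by
      ext1 i j
      simp only [M, Matrix.map_apply, Matrix.add_apply, Matrix.sum_apply, Matrix.smul_apply,
        smul_eq_mul, map_add, map_sum, map_mul, hρC, hρX, hw, Prod.fst_sum, Prod.smul_fst,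
        Finset.mul_sum, Matrix.one_apply, apply_ite ρ, map_one, map_zero]
      congr 1
      exact Finset.sum_congr rfl fun n _ => by ring
    have hc : ∀ i, ρ (c i) = Polynomial.C 1 + Polynomial.X * Polynomial.C (w.2.1 i) := fun i => by
      simp only [c, map_add, map_sum, map_mul, hρC, hρX, hw, Prod.snd_sum, Prod.fst_sum,
        Prod.smul_snd, Prod.smul_fst, Finset.sum_apply, Pi.smul_apply, smul_eq_mul,
        Finset.mul_sum]
      congr 1
      exact Finset.sum_congr rfl fun n _ => by ring
    have ha : ∀ i j l, ρ (a i j l) =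
        Polynomial.C (a₀ i j l) + Polynomial.X * Polynomial.C (w.2.2 i j l) := fun i j l => by
      simp only [a, map_add, map_sum, map_mul, hρC, hρX, hw, Prod.snd_sum,
        Prod.smul_snd, Finset.sum_apply, Pi.smul_apply, smul_eq_mul, Finset.mul_sum]
      congr 1
      exact Finset.sum_congr rfl fun n _ => by ring
    have hD : coeff m.1 (formDeriv (fun _ => 1) a₀ w) = y m := by
      simp only [hw, map_sum, map_smul, hv, coeff_sum, coeff_smul, coeff_monomial,
        Subtype.coe_inj]
      simp
    have hdvd := (C_dvd_iff_dvd_coeff _ _).1 (sq_dvd_generalForm_sub (fun _ => 1) a₀ w) m.1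
    have hfm : ρ (f m) = coeff m.1 (generalForm (1 + (Polynomial.X : Polynomial k) •
        w.1.map Polynomial.C) (fun i => Polynomial.C 1 + Polynomial.X * Polynomial.C (w.2.1 i))
        (fun i j l => Polynomial.C (a₀ i j l) + Polynomial.X * Polynomial.C (w.2.2 i j l))) := by
      have := coeff_map (ρ : MvPolynomial CubicMonomial k →+* Polynomial k)
        (generalForm M c a) m.1
      rw [map_generalForm] at this
      simp only [RingHom.coe_coe, hc, ha, hM] at this
      exact this.symm
    rw [coeff_sub, coeff_add, coeff_C_mul, coeff_map, coeff_map, hD, ← hfm,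
      mul_comm Polynomial.X] at hdvd
    exact hdvd
  have hM0 : M.map (eval 0) = 1 := by
    ext i j
    simp [M, Matrix.sum_apply, Matrix.one_apply, apply_ite]
  -- Its value at the origin is 1.
  have hh : M.det * ∏ i, c i ≠ 0 := by
    intro h0
    have := congrArg (eval 0) h0
    rw [map_mul, RingHom.map_det, RingHom.mapMatrix_apply, hM0] at this
    simp [c, map_prod] at this
  obtain ⟨Φ, hΦ, hΦF⟩ := exists_forall_exists_eval_eq f hf _ hh
  refine ⟨Φ, hΦ, fun F hF hne => ?_⟩
  obtain ⟨x, hx, hxh⟩ := hΦF _ hne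
  rw [map_mul, map_prod, RingHom.map_det, RingHom.mapMatrix_apply] at hxh
  refine ⟨M.map (eval x), fun i => eval x (c i), fun i j l => eval x (a i j l),
    left_ne_zero_of_mul hxh, fun i => ?_, ?_⟩
  · exact Finset.prod_ne_zero_iff.1 (right_ne_zero_of_mul hxh) i (Finset.mem_univ i)
  · rw [← map_generalForm]
    ext m
    by_cases hm : m.degree = 3
    · rw [coeff_map]
      exact (hx ⟨m, hm⟩).symm
    · rw [hF.coeff_eq_zero hm, ((isHomogeneous_generalForm M c a).map _).coeff_eq_zero hm]

/-! ### Normalizing the cubes, and rescaling -/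

theorem generalForm_mul {R : Type*} [CommRing R] (r : R) (M : Matrix (Fin 4) (Fin 4) R)
    (c : Fin 4 → R) (a : Fin 4 → Fin 4 → Fin 4 → R) :
    generalForm M (fun i => r * c i) (fun i j l => r * a i j l) = C r * generalForm M c a := by
  simp only [generalForm, C_mul, mul_add, Finset.mul_sum, mul_assoc]

theorem changeCoords_changeCoords {k : Type*} [Field k] (g h : GL (Fin 4) k)
    (F : MvPolynomial (Fin 4) k) :
    changeCoords g (changeCoords h F) = changeCoords (h * g) F := by
  rw [changeCoords, changeCoords, changeCoords, bind₁_bind₁]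
  congr 2
  ext1 i
  simp only [map_sum, map_mul, bind₁_C_right, bind₁_X_right, Units.val_mul, Matrix.mul_apply,
    Finset.mul_sum, Finset.sum_mul]
  rw [Finset.sum_comm]
  exact Finset.sum_congr rfl fun j _ => Finset.sum_congr rfl fun l _ => by ring

theorem changeCoords_one {k : Type*} [Field k] (F : MvPolynomial (Fin 4) k) :
    changeCoords 1 F = F := by
  have : (fun i => ∑ j, C ((1 : GL (Fin 4) k).1 i j) * X j : Fin 4 → MvPolynomial (Fin 4) k) =
      X := by
    ext1 i
    simp [Matrix.one_apply, apply_ite]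
  rw [changeCoords, this, bind₁_X_left, AlgHom.id_apply]

/-- Over an algebraically closed field the coefficients of the cubes can be normalized to `1`. -/
theorem exists_changeCoords_generalForm {k : Type*} [Field k] [IsAlgClosed k]
    {M : Matrix (Fin 4) (Fin 4) k} {c : Fin 4 → k} (a : Fin 4 → Fin 4 → Fin 4 → k)
    (hM : M.det ≠ 0) (hc : ∀ i, c i ≠ 0) :
    ∃ (g : GL (Fin 4) k) (b : Fin 4 → Fin 4 → Fin 4 → k),
      changeCoords g (generalForm M c a) = emchForm b := by
  choose s hs using fun i => IsAlgClosed.exists_pow_nat_eq (c i) (n := 3) (by norm_num)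
  have hs0 : ∀ i, s i ≠ 0 := fun i h => hc i (by rw [← hs, h]; simp)
  have hdet : (Matrix.diagonal s * M).det ≠ 0 := by
    rw [Matrix.det_mul, Matrix.det_diagonal]
    exact mul_ne_zero (Finset.prod_ne_zero_iff.2 fun i _ => hs0 i) hM
  set P : GL (Fin 4) k := Matrix.GeneralLinearGroup.mkOfDetNeZero _ hdet with hP
  refine ⟨P⁻¹, fun i j l => a i j l / (s i * s j * s l), ?_⟩
  have hrow : ∀ i, ∑ j, C (P.1 i j) * X j = C (s i) * rowForm M i := fun i => by
    simp [hP, Matrix.GeneralLinearGroup.mkOfDetNeZero, rowForm, Finset.mul_sum, mul_assoc]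
  have key : generalForm M c a =
      changeCoords P (emchForm fun i j l => a i j l / (s i * s j * s l)) := by
    simp only [changeCoords, emchForm, generalForm, hrow, map_add, map_sum, map_mul, map_pow,
      bind₁_X_right, bind₁_C_right]
    refine congrArg₂ (· + ·) ?_ ?_
    · refine Finset.sum_congr rfl fun i _ => ?_
      rw [← hs i, C_pow]
      ring
    · refine Finset.sum_congr rfl fun i _ => Finset.sum_congr rfl fun j _ =>
        Finset.sum_congr rfl fun l _ => ?_
      have : a i j l = a i j l / (s i * s j * s l) * (s i * s j * s l) := by
        rw [div_mul_cancel₀]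
        exact mul_ne_zero (mul_ne_zero (hs0 i) (hs0 j)) (hs0 l)
      conv_lhs => rw [this]
      simp only [C_mul]
      ring
  rw [key, changeCoords_changeCoords, mul_inv_cancel, changeCoords_one]

theorem Polynomial.exists_eval_ne_zero_of_infinite {k : Type*} [Field k] [Infinite k]
    {p : Polynomial k} (hp : p ≠ 0) : ∃ t, p.eval t ≠ 0 := by
  by_contra! h
  exact hp (Polynomial.funext fun t => by simp [h])

/-- A form on which a homogeneous component of `Φ` does not vanish has a nonzero multiple on
which `Φ` does not vanish. -/
theorem exists_evalCoeffs_mul_ne_zero {k : Type*} [Field k] [Infinite k]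
    {Φ : MvPolynomial CubicMonomial k} {d : ℕ} {F : MvPolynomial (Fin 4) k}
    (h : evalCoeffs (homogeneousComponent d Φ) F ≠ 0) :
    ∃ t : k, t ≠ 0 ∧ evalCoeffs Φ (C t * F) ≠ 0 := by
  set q : Polynomial k := aeval (fun m : CubicMonomial =>
    Polynomial.X * Polynomial.C (coeff m.1 F)) Φ with hq
  have hqe : ∀ t, q.eval t = evalCoeffs Φ (C t * F) := fun t => by
    rw [hq, evalCoeffs, ← Polynomial.coe_evalRingHom, ← RingHom.coe_coe (aeval _),
      ← RingHom.comp_apply]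
    congr 1
    ext m
    · simp
    · simp [coeff_C_mul]
      ring
  have hcomp : ∀ e, aeval (fun m : CubicMonomial =>
      Polynomial.X * Polynomial.C (coeff m.1 F)) (homogeneousComponent e Φ) =
        Polynomial.C (evalCoeffs (homogeneousComponent e Φ) F) * Polynomial.X ^ e := fun e => by
    rw [aeval_mul_of_isHomogeneous (homogeneousComponent_isHomogeneous e Φ), mul_comm]
    congr 1
    rw [evalCoeffs, ← RingHom.comp_apply Polynomial.C, ← RingHom.coe_coe (aeval _)]
    congr 1
    ext m
    · simp
    · simp
  have hqc : q.coeff d = evalCoeffs (homogeneousComponent d Φ) F := by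
    rw [hq, ← sum_homogeneousComponent Φ, map_sum, Polynomial.finsetSum_coeff]
    simp only [sum_homogeneousComponent, hcomp, Polynomial.coeff_C_mul_X_pow]
    rw [Finset.sum_ite_eq]
    split_ifs with hd
    · rfl
    · rw [homogeneousComponent_eq_zero _ _ (by simpa using hd)]
      simp [evalCoeffs]
  have hq0 : q ≠ 0 := fun h0 => h (by rw [← hqc, h0, Polynomial.coeff_zero])
  -- The extra factor X forces t ≠ 0.
  obtain ⟨t, ht⟩ := Polynomial.exists_eval_ne_zero_of_infinite
    (mul_ne_zero Polynomial.X_ne_zero hq0)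
  rw [Polynomial.eval_mul, Polynomial.eval_X, hqe] at ht
  exact ⟨t, left_ne_zero_of_mul ht, right_ne_zero_of_mul ht⟩

/-! ### Density in the space of smooth cubics -/

theorem exists_eval_eq_evalCoeffs_line {k : Type*} [Field k]
    (Φ : MvPolynomial CubicMonomial k) (F H : MvPolynomial (Fin 4) k) :
    ∃ q : Polynomial k, ∀ t, q.eval t = evalCoeffs Φ (F + C t * H) := by
  refine ⟨aeval (fun m : CubicMonomial =>
    Polynomial.C (coeff m.1 F) + Polynomial.X * Polynomial.C (coeff m.1 H)) Φ, fun t => ?_⟩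
  rw [evalCoeffs, ← Polynomial.coe_evalRingHom, ← RingHom.coe_coe (aeval _), ← RingHom.comp_apply]
  congr 1
  ext m
  · simp
  · simp [coeff_C_mul]
    ring

/-- The space of smooth cubic surfaces is irreducible: nonempty principal open subsets are dense. -/
theorem exists_isSmoothCubicForm_evalCoeffs_ne_zero {k : Type*} [Field k] [IsAlgClosed k]
    {Φ Ψ : MvPolynomial CubicMonomial k} (hΦ : Φ ≠ 0) {F : MvPolynomial (Fin 4) k}
    (hF : IsSmoothCubicForm F) (hΨ : evalCoeffs Ψ F ≠ 0) :
    ∃ G, IsSmoothCubicForm G ∧ evalCoeffs Ψ G ≠ 0 ∧ evalCoeffs Φ G ≠ 0 := by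
  classical
  have : Finite CubicMonomial := finite_degree_eq 3
  let : Fintype CubicMonomial := Fintype.ofFinite _
  have : Infinite k := IsAlgClosed.instInfinite
  obtain ⟨y, hy⟩ : ∃ y, eval y Φ ≠ 0 := by
    by_contra! h
    exact hΦ (MvPolynomial.funext fun y => by simp [h])
  let E : MvPolynomial (Fin 4) k := ∑ m : CubicMonomial, monomial m.1 (y m)
  have hE : E.IsHomogeneous 3 := IsHomogeneous.sum _ _ _ fun m _ => isHomogeneous_monomial _ m.2
  have hEΦ : evalCoeffs Φ E ≠ 0 := by
    have : (fun m : CubicMonomial => coeff m.1 E) = y := by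
      ext m
      simp [E, coeff_sum, coeff_monomial, Subtype.coe_inj]
    rwa [evalCoeffs, this]
  -- The line runs from F at t = 0, where Ψ ≠ 0, to E at t = 1, where Φ ≠ 0; E itself need not be
  -- smooth.
  obtain ⟨p, hp, hps⟩ := hF.exists_polynomial (hE.sub hF.isHomogeneous)
  obtain ⟨q, hq⟩ := exists_eval_eq_evalCoeffs_line Φ F (E - F)
  obtain ⟨r, hr⟩ := exists_eval_eq_evalCoeffs_line Ψ F (E - F)
  have hq0 : q ≠ 0 := by
    rintro rfl
    have := hq 1
    rw [Polynomial.eval_zero, C_1, one_mul, add_sub_cancel] at this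
    exact hEΦ this.symm
  have hr0 : r ≠ 0 := by
    rintro rfl
    have := hr 0
    rw [Polynomial.eval_zero, C_0, zero_mul, add_zero] at this
    exact hΨ this.symm
  obtain ⟨t, ht⟩ := Polynomial.exists_eval_ne_zero_of_infinite
    (mul_ne_zero (mul_ne_zero hp hr0) hq0)
  rw [Polynomial.eval_mul, Polynomial.eval_mul, hq, hr] at ht
  exact ⟨_, hps t (left_ne_zero_of_mul (left_ne_zero_of_mul ht)),
    right_ne_zero_of_mul (left_ne_zero_of_mul ht), right_ne_zero_of_mul ht⟩

theorem exists_isSmoothCubicForm (k : Type*) [Field k] :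
    ∃ F : MvPolynomial (Fin 4) k, IsSmoothCubicForm F := by
  by_cases h3 : (3 : k) = 0
  -- The Fermat cubic is not smooth in characteristic 3. Here ∂₃, ∂₂, ∂₁ kill x₂, x₁, x₀ in turn,
  -- and then F = 0 kills x₃.
  · refine ⟨X 0 ^ 2 * X 1 + X 1 ^ 2 * X 2 + X 2 ^ 2 * X 3 + X 3 ^ 3, ?_, fun x hx hF => ?_⟩
    · have h := fun i => isHomogeneous_X k (i : Fin 4)
      exact (((((h 0).pow 2).mul (h 1)).add (((h 1).pow 2).mul (h 2))).add
        (((h 2).pow 2).mul (h 3))).add ((h 3).pow 3)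
    · by_contra! hall
      apply hx
      have e1 := hall 1
      have e2 := hall 2
      have e3 := hall 3
      simp [pderiv_X, h3] at hF e1 e2 e3
      have x2 : x 2 = 0 := by simpa using e3
      have x1 : x 1 = 0 := by simpa [x2] using e2
      have x0 : x 0 = 0 := by simpa [x1, x2] using e1
      have x3 : x 3 = 0 := by simpa [x0, x1, x2] using hF
      ext i
      fin_cases i <;> simp [x0, x1, x2, x3]
  · refine ⟨∑ i, X i ^ 3, ?_, fun x hx _ => ?_⟩
    · exact IsHomogeneous.sum _ _ _ fun i _ => (isHomogeneous_X k i).pow 3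
    · by_contra! hall
      apply hx
      ext i
      have := hall i
      simp [pderiv_X, Pi.single_apply, h3] at this
      simpa using this

theorem evalCoeffs_mul {k : Type*} [Field k] (Φ Ψ : MvPolynomial CubicMonomial k)
    (F : MvPolynomial (Fin 4) k) : evalCoeffs (Φ * Ψ) F = evalCoeffs Φ F * evalCoeffs Ψ F :=
  map_mul _ _ _

theorem dense_setOf_evalCoeffs_ne_zero {k : Type*} [Field k] [IsAlgClosed k]
    {Φ : MvPolynomial CubicMonomial k} (hΦ : Φ ≠ 0) :
    Dense {F : SmoothCubic k | evalCoeffs Φ F.1 ≠ 0} := by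
  have hbasis := TopologicalSpace.isTopologicalBasis_of_subbasis_of_inter
    (t := SmoothCubic.zariskiTopology k) rfl (by
      rintro _ ⟨Φ₁, d₁, h₁, rfl⟩ _ ⟨Φ₂, d₂, h₂, rfl⟩
      refine ⟨Φ₁ * Φ₂, d₁ + d₂, h₁.mul h₂, ?_⟩
      ext F
      simp [evalCoeffs_mul])
  rw [hbasis.dense_iff]
  have key : ∀ Ψ : MvPolynomial CubicMonomial k,
      {F : SmoothCubic k | evalCoeffs Ψ F.1 ≠ 0}.Nonempty →
      ({F : SmoothCubic k | evalCoeffs Ψ F.1 ≠ 0} ∩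
        {F : SmoothCubic k | evalCoeffs Φ F.1 ≠ 0}).Nonempty := by
    rintro Ψ ⟨F, hF⟩
    obtain ⟨G, hG, hG₁, hG₂⟩ := exists_isSmoothCubicForm_evalCoeffs_ne_zero hΦ F.2 hF
    exact ⟨⟨G, hG⟩, hG₁, hG₂⟩
  rintro o (rfl | ⟨Ψ, d, -, rfl⟩) ho
  -- The basis adjoins the whole space to the generating sets; it is the case Ψ = 1.
  · have h1 : {F : SmoothCubic k | evalCoeffs 1 F.1 ≠ 0} = Set.univ := by
      simp [evalCoeffs]
    rw [← h1] at ho ⊢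
    exact key 1 ho
  · exact key Ψ ho

theorem mainTheorem12 (k : Type*) [Field k] [IsAlgClosed k] :
    ∃ U : Set (SmoothCubic k), IsOpen U ∧ Dense U ∧ U.Nonempty ∧
      ∀ F ∈ U, ∃ (g : GL (Fin 4) k) (a : Fin 4 → Fin 4 → Fin 4 → k),
        changeCoords g F.1 = emchForm a := by
  have : Infinite k := IsAlgClosed.instInfinite
  obtain ⟨Φ, hΦ, hΦF⟩ := exists_eq_generalForm k
  obtain ⟨d, hd⟩ : ∃ d, homogeneousComponent d Φ ≠ 0 := by
    by_contra! hall
    exact hΦ (by rw [← sum_homogeneousComponent Φ]; simp [hall])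
  have hdense := dense_setOf_evalCoeffs_ne_zero hd
  obtain ⟨F₀, hF₀⟩ := exists_isSmoothCubicForm k
  have : Nonempty (SmoothCubic k) := ⟨⟨F₀, hF₀⟩⟩
  refine ⟨_, TopologicalSpace.isOpen_generateFrom_of_mem
    ⟨_, d, homogeneousComponent_isHomogeneous d Φ, rfl⟩, hdense, hdense.nonempty, fun F hF => ?_⟩
  obtain ⟨t, ht, htF⟩ := exists_evalCoeffs_mul_ne_zero hF
  obtain ⟨M, c, a, hM, hc, hFM⟩ := hΦF _ (F.2.isHomogeneous.C_mul t) htF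
  -- The family is stable under scalars, so a representation of tF gives one of F.
  have hFeq : F.1 = generalForm M (fun i => t⁻¹ * c i) (fun i j l => t⁻¹ * a i j l) := by
    rw [generalForm_mul, ← hFM, ← mul_assoc, ← C_mul, inv_mul_cancel₀ ht, C_1, one_mul]
  rw [hFeq]
  exact exists_changeCoords_generalForm _ hM fun i => mul_ne_zero (inv_ne_zero ht) (hc i)
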